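/- Let $d>1$ and $\lambda>0$, and let $\mathcal X_\lambda$ be a homogeneous Poisson point process of intensity $\lambda$ in $\mathbb R^d$ with the Euclidean distance. For $k\in\mathbb N$ and $V\subseteq\mathbb R^d$ let $N_k(V)$ be the maximum number of vertices that can be properly colored with $k$ colors in the graph on $V$ in which two distinct points are adjacent if and only if their distance is at most $1$, and put $$a_{k,\lambda}:=\inf_{t>0}\frac{\mathbb E\,N_k([0,t]^d\cap\mathcal X_\lambda)}{\lambda t^d}.$$ Let $V_d(r)$ be the volume of a ball of radius $r$ in $\mathbb R^d$. Let $g_{\max}$ be the supremum of the densities $\lim_{t\to\infty}|V\cap[0,t]^d|/t^d$, over all sets $V\subseteq\mathbb R_+^d$ for which this limit exists and any two distinct points of which are at distance greater than $1$. For $s>0$ let $m(s)$ be the minimum number of sets $B_1,\dots,B_{m(s)}\subseteq\mathbb R^d$ such that (i) every point of $\mathbb R^d$ is within distance $s$ of some point of $B_1\cup\dots\cup B_{m(s)}$, and (ii) any two distinct points of the same $B_j$ are at distance greater than $1+2s$. Then: 1. $g_{\max}$ is finite, and $g_{\max}\le 1/V_d(1/2)$. 2. For every $k$, $a_{k,\lambda}\le\min\{1,\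 k\,g_{\max}/\lambda\}$. 3. For every $s>0$, the number $m(s)$ is finite, and for every $k$, $$a_{k,\lambda}\ \ge\ \frac{\mathbb E\big[\min\{\mathrm{Po}(\lambda V_d(s)),\ \lfloor k/m(s)\rfloor\}\big]}{\lambda V_d(s)},$$ where $\mathrm{Po}(\mu)$ denotes a Poisson random variable with mean $\mu$. 4. $a_{k,\lambda}\to1$ as $k\to\infty$. -/

import Mathlib

open MeasureTheory ProbabilityTheory Filter Topology
open scoped ENNReal

namespace GeomColoring

/-- Euclidean space of dimension `d`, with the `ℓ²` distance. -/
abbrev Space (d : ℕ) : Type := EuclideanSpace ℝ (Fin d)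

/-- The cube `[0, t]^d`. -/
def cube (d : ℕ) (t : ℝ) : Set (Space d) := {x | ∀ i, x i ∈ Set.Icc (0 : ℝ) t}

/-- The geometric graph on the vertex set `V`: two distinct points are joined
if and only if their distance is at most `r`. -/
def geomGraph {d : ℕ} (r : ℝ) (V : Set (Space d)) : SimpleGraph V where
  Adj u v := u ≠ v ∧ dist u v ≤ r
  symm := ⟨fun _ _ h => ⟨h.1.symm, by rw [dist_comm]; exact h.2⟩⟩
  loopless := ⟨fun _ h => h.1 rfl⟩

/-- The maximum number of vertices of the geometric graph on `V` that can be properly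
coloured with `k` colours: the largest cardinality of a set of vertices whose induced
subgraph is `k`-colourable. -/
noncomputable def maxColored {d : ℕ} (k : ℕ) (r : ℝ) (V : Set (Space d)) : ℕ∞ :=
  ⨆ (U : Set V) (_ : ((geomGraph r V).induce U).Colorable k), U.encard

/-- `X` is a homogeneous Poisson point process of intensity `lam` on Euclidean space,
regarded as a random set of points: the number of points in a Borel set of finite volume
is Poisson with mean `lam` times the volume, and the numbers of points in finitely many
pairwise disjoint Borel sets are independent. -/
structure IsPoissonProcess {d : ℕ} {Ω : Type*} [MeasurableSpace Ω] (P : Measure Ω)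
    (X : Ω → Set (Space d)) (lam : ℝ) : Prop where
  measurable_count : ∀ A : Set (Space d), MeasurableSet A →
    Measurable fun ω => (X ω ∩ A).encard
  law_count : ∀ A : Set (Space d), MeasurableSet A → volume A ≠ ∞ →
    P.map (fun ω => (X ω ∩ A).encard) =
      (poissonMeasure (Real.toNNReal (lam * volume.real A))).map (fun n : ℕ => (n : ℕ∞))
  indep_count : ∀ (n : ℕ) (A : Fin n → Set (Space d)), (∀ i, MeasurableSet (A i)) →
    (Pairwise fun i j => Disjoint (A i) (A j)) →
    iIndepFun (fun i ω => (X ω ∩ A i).encard) P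

/-- The mean colouring ratio `E[N_{k,1}(X ∩ [0, t]^d)] / (lam * t^d)`; the expectation of
the nonnegative extended-integer-valued variable is its Lebesgue integral. -/
noncomputable def meanRatio {d : ℕ} {Ω : Type*} [MeasurableSpace Ω] (P : Measure Ω)
    (X : Ω → Set (Space d)) (lam : ℝ) (k : ℕ) (t : ℝ) : ℝ :=
  (∫⁻ ω, (maxColored k 1 (X ω ∩ cube d t) : ℝ≥0∞) ∂P).toReal / (lam * t ^ d)

/-- The limiting colouring ratio `a_{k,lam}`, the infimum over `t > 0` of the mean
colouring ratio of the cube `[0, t]^d`. -/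
noncomputable def colorConst {d : ℕ} {Ω : Type*} [MeasurableSpace Ω] (P : Measure Ω)
    (X : Ω → Set (Space d)) (lam : ℝ) (k : ℕ) : ℝ :=
  sInf (meanRatio P X lam k '' Set.Ioi 0)

/-- The volume `V_d(r)` of a ball of radius `r` in dimension `d`. -/
noncomputable def ballVol (d : ℕ) (r : ℝ) : ℝ := volume.real (Metric.ball (0 : Space d) r)

/-- The set of all densities of point sets `V` in the nonnegative orthant no two points of
which are within distance `1`. The density of `V` is the limit of the number of its points
in `[0, t]^d` divided by `t^d`. -/
def packingDensities (d : ℕ) : Set ℝ :=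
  {δ | ∃ V : Set (Space d), (∀ x ∈ V, ∀ i, 0 ≤ x i) ∧
    (V.Pairwise fun x y => 1 < dist x y) ∧
    Tendsto (fun t : ℝ => ((V ∩ cube d t).ncard : ℝ) / t ^ d) atTop (𝓝 δ)}

/-- The maximal density `g_max` of a point set no two points of which are within
distance `1`. -/
noncomputable def gMax (d : ℕ) : ℝ := sSup (packingDensities d)

/-- `B 0, …, B (m - 1)` are sets of anchor points for the radius `s`: every point of the
space is within distance `s` of an anchor point, and no two points of the same set are
within distance `1 + 2 s`. -/
def IsAnchorFamily {d m : ℕ} (s : ℝ) (B : Fin m → Set (Space d)) : Prop :=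
  (∀ x : Space d, ∃ j, ∃ b ∈ B j, dist x b ≤ s) ∧
    ∀ j, (B j).Pairwise fun x y => 1 + 2 * s < dist x y

/-- The numbers of sets in anchor families for the radius `s`. -/
def anchorSizes (d : ℕ) (s : ℝ) : Set ℕ :=
  {m | ∃ B : Fin m → Set (Space d), IsAnchorFamily s B}

/-- The minimum number `m(s)` of sets in an anchor family for the radius `s`. -/
noncomputable def anchorNumber (d : ℕ) (s : ℝ) : ℕ := sInf (anchorSizes d s)

/-- The mean `E[min {Po(μ), q}]`. -/
noncomputable def truncatedPoissonMean (μ : ℝ) (q : ℕ) : ℝ :=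
  ∫ n : ℕ, ((min n q : ℕ) : ℝ) ∂(poissonMeasure (Real.toNNReal μ))

end GeomColoring

/-! Upper bound: a colour class is a set with pairwise distances greater than `1`. Repeating its
part in `[0, t]^d` with period `t + 2` gives an admissible packing, so it has at most `gMax d * (t +
2) ^ d` points (`ncard_le_gMax_mul`). Sum over the `k` colours, divide by `lam * t ^ d` and let `t →
∞`.

Lower bound: an anchor family cuts the cube into disjoint cells of radius `s` with `m` labels. Cells
with the same label are more than `1` apart and can share a palette of `q = k / m` colours, so `min
(|X ∩ C|, q)` points of each cell `C` can be coloured (`sum_min_le_maxColored`). For a Poisson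
variable, `E[min (Po(r), q)] / r` decreases in `r` (`poissonRatio_anti`), so a cell, being no larger
than a ball of radius `s`, has at least the ratio of that ball. The cell volumes add up to `t ^ d`,
which gives the bound for every `t`.

For `s = 1` the lower bound tends to `1` with `k` by monotone convergence, and `1` is a trivial
upper bound. -/

namespace GeomColoring

open scoped NNReal

/-! ### Truncated means of Poisson variables. -/

section Poisson

theorem lintegral_poissonMeasure (r : ℝ≥0) (f : ℕ → ℝ≥0∞) :
    ∫⁻ n, f n ∂poissonMeasure r =
      ∑' n, ENNReal.ofReal (Real.exp (-r) * r ^ n / n.factorial) * f n := by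
  rw [lintegral_countable']
  simp_rw [poissonMeasure_singleton, mul_comm]

/-- The Stein–Chen identity of the Poisson distribution. -/
theorem lintegral_natCast_mul_poissonMeasure (r : ℝ≥0) (g : ℕ → ℝ≥0∞) :
    ∫⁻ n, n * g n ∂poissonMeasure r = r * ∫⁻ n, g (n + 1) ∂poissonMeasure r := by
  rw [lintegral_poissonMeasure, lintegral_poissonMeasure, ← ENNReal.tsum_mul_left,
    tsum_eq_zero_add' ENNReal.summable]
  simp only [Nat.cast_zero, zero_mul, mul_zero, zero_add]
  refine tsum_congr fun n => ?_
  have h : ENNReal.ofReal (Real.exp (-r) * r ^ (n + 1) / (n + 1).factorial) * ((n + 1 : ℕ) : ℝ≥0∞)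
      = r * ENNReal.ofReal (Real.exp (-r) * r ^ n / n.factorial) := by
    rw [← ENNReal.ofReal_natCast, ← ENNReal.ofReal_coe_nnreal, ← ENNReal.ofReal_mul (by positivity),
      ← ENNReal.ofReal_mul (by positivity), Nat.factorial_succ]
    congr 1
    push_cast
    field_simp
    ring
  rw [← mul_assoc, h, mul_assoc]

theorem lintegral_natCast_poissonMeasure (r : ℝ≥0) :
    ∫⁻ n, (n : ℝ≥0∞) ∂poissonMeasure r = r := by
  simpa using lintegral_natCast_mul_poissonMeasure r fun _ => 1

/-- A `Po(r + u)` variable is the sum of independent `Po(r)` and `Po(u)` variables, and the second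
summand can only lower `h`. -/
theorem lintegral_poissonMeasure_anti {h : ℕ → ℝ≥0∞} (hh : Antitone h) :
    Antitone fun r : ℝ≥0 => ∫⁻ n, h n ∂poissonMeasure r := by
  intro r r' hr
  obtain ⟨u, rfl⟩ := exists_add_of_le hr
  simp only
  rw [← poissonMeasure_conv_poissonMeasure, Measure.lintegral_conv (by fun_prop)]
  refine lintegral_mono fun x => ?_
  calc ∫⁻ y, h (x + y) ∂poissonMeasure u ≤ ∫⁻ _, h x ∂poissonMeasure u :=
        lintegral_mono fun y => hh (Nat.le_add_right x y)
    _ = h x := by simp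

/-- The ratio `E[min {Po(r), q}] / r`, in a form that is meaningful also for `r = 0`. -/
noncomputable def poissonRatio (q : ℕ) (r : ℝ≥0) : ℝ≥0∞ :=
  ∫⁻ n : ℕ, min 1 ((q : ℝ≥0∞) / ((n + 1 : ℕ) : ℝ≥0∞)) ∂poissonMeasure r

theorem poissonRatio_anti (q : ℕ) : Antitone (poissonRatio q) :=
  lintegral_poissonMeasure_anti fun a b hab => by
    gcongr

/-- Stein–Chen with `g n = min 1 (q / n)`; the factor `n` makes the value `g 0` irrelevant. -/
theorem lintegral_min_poissonMeasure (q : ℕ) (r : ℝ≥0) :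
    ∫⁻ n : ℕ, ((min n q : ℕ) : ℝ≥0∞) ∂poissonMeasure r = r * poissonRatio q r := by
  rw [poissonRatio, ← lintegral_natCast_mul_poissonMeasure r fun n => min 1 ((q : ℝ≥0∞) / n)]
  refine lintegral_congr fun n => ?_
  rcases eq_or_ne n 0 with rfl | hn
  · simp
  · have hmono : Monotone fun x : ℝ≥0∞ => (n : ℝ≥0∞) * x := fun _ _ h => by dsimp only; gcongr
    rw [hmono.map_min, mul_one, ENNReal.mul_div_cancel (by simpa) (by simp), (Nat.mono_cast (α := ℝ≥0∞)).map_min]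

theorem tendsto_poissonRatio (r : ℝ≥0) : Tendsto (fun q => poissonRatio q r) atTop (𝓝 1) := by
  have h : ∫⁻ _ : ℕ, (1 : ℝ≥0∞) ∂poissonMeasure r = 1 := by simp
  rw [← h]
  refine lintegral_tendsto_of_tendsto_of_monotone (fun q => by fun_prop)
    (ae_of_all _ fun n a b hab => by dsimp only; gcongr) (ae_of_all _ fun n => ?_)
  refine tendsto_const_nhds.congr' ?_
  filter_upwards [eventually_ge_atTop (n + 1)] with q hq
  rw [min_eq_left]
  rw [ENNReal.le_div_iff_mul_le (by simp) (by simp), one_mul]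
  exact_mod_cast hq

theorem truncatedPoissonMean_div {μ : ℝ} (hμ : 0 < μ) (q : ℕ) :
    truncatedPoissonMean μ q / μ = (poissonRatio q μ.toNNReal).toReal := by
  have h : truncatedPoissonMean μ q = μ * (poissonRatio q μ.toNNReal).toReal := by
    rw [truncatedPoissonMean, integral_eq_lintegral_of_nonneg_ae (ae_of_all _ fun n => by positivity)
      (by fun_prop)]
    simp_rw [ENNReal.ofReal_natCast]
    rw [lintegral_min_poissonMeasure, ENNReal.toReal_mul]
    simp [hμ.le]
  rw [h, mul_div_cancel_left₀ _ hμ.ne']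

variable {d : ℕ} {Ω : Type*} [MeasurableSpace Ω] {P : Measure Ω}
  {X : Ω → Set (Space d)} {lam : ℝ}

theorem IsPoissonProcess.lintegral_count (hX : IsPoissonProcess P X lam)
    {A : Set (Space d)} (hA : MeasurableSet A) (hA' : volume A ≠ ∞) (f : ℕ∞ → ℝ≥0∞) :
    ∫⁻ ω, f (X ω ∩ A).encard ∂P = ∫⁻ n : ℕ, f n ∂poissonMeasure (lam * volume.real A).toNNReal := by
  rw [← lintegral_map (f := f) (.of_discrete) (hX.measurable_count A hA), hX.law_count A hA hA',
    lintegral_map (.of_discrete) (.of_discrete)]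

end Poisson

/-! ### Packing density and the upper bound. -/

section Packing

variable {d : ℕ}

theorem measurableSet_box (a b : Fin d → ℝ) :
    MeasurableSet {x : Space d | ∀ i, x i ∈ Set.Icc (a i) (b i)} := by
  have h : {x : Space d | ∀ i, x i ∈ Set.Icc (a i) (b i)} =
      ⋂ i, (fun x : Space d => x i) ⁻¹' Set.Icc (a i) (b i) := by ext; simp
  rw [h]
  exact .iInter fun i => measurableSet_Icc.preimage (by fun_prop)

theorem volume_box (a b : Fin d → ℝ) :
    volume {x : Space d | ∀ i, x i ∈ Set.Icc (a i) (b i)} = ∏ i, ENNReal.ofReal (b i - a i) := by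
  rw [← Real.volume_Icc_pi, ← (PiLp.volume_preserving_ofLp (Fin d)).measure_preimage
    measurableSet_Icc.nullMeasurableSet]
  congr 1
  ext x
  simp [Pi.le_def, forall_and]

theorem measurableSet_cube (t : ℝ) : MeasurableSet (cube d t) := measurableSet_box _ _

theorem volume_cube {t : ℝ} (ht : 0 ≤ t) : volume (cube d t) = ENNReal.ofReal (t ^ d) := by
  rw [cube, volume_box]
  simp [ENNReal.ofReal_pow ht]

theorem volume_real_cube {t : ℝ} (ht : 0 ≤ t) : volume.real (cube d t) = t ^ d := by
  rw [measureReal_def, volume_cube ht, ENNReal.toReal_ofReal (by positivity)]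

theorem ballVol_pos {r : ℝ} (hr : 0 < r) : 0 < ballVol d r :=
  ENNReal.toReal_pos (Metric.measure_ball_pos _ _ hr).ne' measure_ball_lt_top.ne

theorem abs_sub_apply_le_dist (x y : Space d) (i : Fin d) : |x i - y i| ≤ dist x y := by
  simpa [dist_eq_norm] using PiLp.norm_apply_le (x - y) i

/-- The balls of radius `1 / 2` around the points are disjoint and lie in `[-1/2, t + 1/2]^d`. -/
theorem card_mul_ballVol_le {t : ℝ} (ht : 0 ≤ t) (F : Finset (Space d)) (hF : ↑F ⊆ cube d t)
    (hsep : (F : Set (Space d)).Pairwise fun x y => 1 < dist x y) :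
    F.card * ballVol d (1 / 2) ≤ (t + 1) ^ d := by
  have hdisj : (F : Set (Space d)).PairwiseDisjoint fun x => Metric.ball x (1 / 2 : ℝ) :=
    fun x hx y hy hxy => Metric.ball_disjoint_ball (by linarith [hsep hx hy hxy])
  have hsub : (⋃ x ∈ F, Metric.ball x (1 / 2 : ℝ)) ⊆
      {x : Space d | ∀ i, x i ∈ Set.Icc (-(1 / 2) : ℝ) (t + 1 / 2)} := by
    intro y hy i
    obtain ⟨x, hx, hy⟩ := Set.mem_iUnion₂.1 hy
    have h1 := abs_le.1 ((abs_sub_apply_le_dist y x i).trans (Metric.mem_ball.1 hy).le)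
    have h2 := hF hx i
    constructor <;> linarith [h2.1, h2.2]
  have h := measure_mono (μ := volume) hsub
  rw [measure_biUnion_finset hdisj fun x _ => measurableSet_ball, volume_box] at h
  simp only [Measure.addHaar_ball_center volume _ (1 / 2 : ℝ), Finset.sum_const, Finset.prod_const,
    Finset.card_univ, Fintype.card_fin, nsmul_eq_mul] at h
  have h' := ENNReal.toReal_mono (by finiteness) h
  rw [ENNReal.toReal_mul, ENNReal.toReal_pow, ENNReal.toReal_ofReal (by linarith)] at h'
  calc _ = _ := by rw [ENNReal.toReal_natCast]; rfl
    _ ≤ _ := h'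
    _ = _ := by ring

theorem finite_of_separated {t : ℝ} (ht : 0 ≤ t) {V : Set (Space d)} (hV : V ⊆ cube d t)
    (hsep : V.Pairwise fun x y => 1 < dist x y) : V.Finite := by
  by_contra hinf
  obtain ⟨n, hn⟩ := exists_nat_gt ((t + 1) ^ d / ballVol d (1 / 2))
  obtain ⟨F, hFV, rfl⟩ := Set.Infinite.exists_subset_card_eq hinf n
  have := card_mul_ballVol_le ht F (hFV.trans hV) (hsep.mono hFV)
  rw [div_lt_iff₀ (ballVol_pos (by norm_num))] at hn
  linarith

theorem ncard_mul_ballVol_le {t : ℝ} (ht : 0 ≤ t) {V : Set (Space d)} (hV : V ⊆ cube d t)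
    (hsep : V.Pairwise fun x y => 1 < dist x y) :
    V.ncard * ballVol d (1 / 2) ≤ (t + 1) ^ d := by
  have hfin := finite_of_separated ht hV hsep
  rw [Set.ncard_eq_toFinset_card V hfin]
  exact card_mul_ballVol_le ht _ (by simpa) (by simpa)

theorem packingDensities_le {δ : ℝ} (hδ : δ ∈ packingDensities d) :
    δ ≤ 1 / ballVol d (1 / 2) := by
  obtain ⟨V, -, hsep, hlim⟩ := hδ
  have hlim' : Tendsto (fun t : ℝ => ((1 + t⁻¹) ^ d) / ballVol d (1 / 2)) atTop
      (𝓝 ((1 + 0) ^ d / ballVol d (1 / 2))) :=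
    ((tendsto_inv_atTop_zero.const_add 1).pow d).div_const _
  rw [add_zero, one_pow] at hlim'
  refine le_of_tendsto_of_tendsto hlim hlim' ?_
  filter_upwards [eventually_gt_atTop 0] with t ht
  have h := ncard_mul_ballVol_le ht.le Set.inter_subset_right (hsep.mono Set.inter_subset_left)
  rw [div_le_div_iff₀ (by positivity) (ballVol_pos (by norm_num)), ← mul_pow]
  rwa [show (1 + t⁻¹) * t = t + 1 by field_simp]

theorem bddAbove_packingDensities : BddAbove (packingDensities d) :=
  ⟨_, fun _ => packingDensities_le⟩

theorem zero_mem_packingDensities : (0 : ℝ) ∈ packingDensities d :=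
  ⟨∅, by simp, by simp, by simp⟩

theorem gMax_le : gMax d ≤ 1 / ballVol d (1 / 2) :=
  csSup_le ⟨_, zero_mem_packingDensities⟩ fun _ => packingDensities_le

theorem gMax_nonneg : 0 ≤ gMax d := le_csSup bddAbove_packingDensities zero_mem_packingDensities

/-- The translate of `x` by the vector `L • z` of a cubic lattice. -/
noncomputable def latticeTranslate (L : ℝ) (x : Space d) (z : Fin d → ℕ) : Space d :=
  WithLp.toLp 2 fun i => x i + L * z i

theorem latticeTranslate_apply (L : ℝ) (x : Space d) (z : Fin d → ℕ) (i : Fin d) :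
    latticeTranslate L x z i = x i + L * z i := rfl

theorem dist_latticeTranslate_self (L : ℝ) (x y : Space d) (z : Fin d → ℕ) :
    dist (latticeTranslate L x z) (latticeTranslate L y z) = dist x y := by
  simp [EuclideanSpace.dist_eq, latticeTranslate_apply]

theorem one_lt_dist_latticeTranslate {t : ℝ} {x y : Space d} (hx : x ∈ cube d t)
    (hy : y ∈ cube d t) {z w : Fin d → ℕ} (hzw : z ≠ w) :
    1 < dist (latticeTranslate (t + 2) x z) (latticeTranslate (t + 2) y w) := by
  obtain ⟨i, hi⟩ := Function.ne_iff.1 hzw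
  refine lt_of_lt_of_le ?_ (abs_sub_apply_le_dist _ _ i)
  simp only [latticeTranslate_apply]
  obtain ⟨hx0, hxt⟩ := hx i
  obtain ⟨hy0, hyt⟩ := hy i
  rcases lt_or_gt_of_ne hi with h | h
  · have h' : (z i : ℝ) + 1 ≤ w i := by exact_mod_cast h
    rw [lt_abs]; right; nlinarith
  · have h' : (w i : ℝ) + 1 ≤ z i := by exact_mod_cast h
    rw [lt_abs]; left; nlinarith

/-- The witness is the periodic extension of `F` with period `t + 2`; the excess of `2` over the
side of the cube keeps different copies more than `1` apart. -/
theorem card_div_mem_packingDensities {t : ℝ} (ht : 0 ≤ t) (F : Finset (Space d))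
    (hF : ↑F ⊆ cube d t) (hsep : (F : Set (Space d)).Pairwise fun x y => 1 < dist x y) :
    F.card / (t + 2) ^ d ∈ packingDensities d := by
  have hinj : Set.InjOn (fun p : Space d × (Fin d → ℕ) => latticeTranslate (t + 2) p.1 p.2)
      ((F : Set (Space d)) ×ˢ Set.univ) := by
    rintro ⟨x, z⟩ ⟨hx, -⟩ ⟨y, w⟩ ⟨hy, -⟩ hxy
    have h0 : dist (latticeTranslate (t + 2) x z) (latticeTranslate (t + 2) y w) = 0 := by
      simpa using hxy
    have hzw : z = w := by
      by_contra hne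
      linarith [one_lt_dist_latticeTranslate (hF hx) (hF hy) hne]
    subst hzw
    rw [dist_latticeTranslate_self, dist_eq_zero] at h0
    exact Prod.ext h0 rfl
  let G : ℕ → Finset (Space d × (Fin d → ℕ)) := fun n =>
    F ×ˢ Fintype.piFinset fun _ => Finset.range n
  let V : Set (Space d) := (fun p : Space d × (Fin d → ℕ) => latticeTranslate (t + 2) p.1 p.2) ''
    ((F : Set (Space d)) ×ˢ Set.univ)
  have hcard (n : ℕ) : ((fun p : Space d × (Fin d → ℕ) => latticeTranslate (t + 2) p.1 p.2) ''
      (G n : Set (Space d × (Fin d → ℕ)))).ncard = F.card * n ^ d := by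
    rw [Set.InjOn.ncard_image, Set.ncard_coe_finset]
    · simp [G]
    · exact hinj.mono fun p hp => by simp [G] at hp; simp [hp.1]
  have hVsep : V.Pairwise fun x y => 1 < dist x y := by
    rintro _ ⟨⟨x, z⟩, ⟨hx, -⟩, rfl⟩ _ ⟨⟨y, w⟩, ⟨hy, -⟩, rfl⟩ hne
    dsimp only at hx hy hne ⊢
    by_cases hzw : z = w
    · subst hzw
      rw [dist_latticeTranslate_self]
      exact hsep hx hy fun h => hne (by rw [h])
    · exact one_lt_dist_latticeTranslate (hF hx) (hF hy) hzw
  have hL : 0 < t + 2 := by linarith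
  -- Only copies with all indices at most `⌊R / (t + 2)⌋` can meet the cube of side `R`, and those
  -- with all indices strictly below that floor lie inside it. The two counts agree to leading
  -- order.
  have hupper {R : ℝ} (hR : 0 ≤ R) :
      (V ∩ cube d R).ncard ≤ F.card * (⌊(t + 2)⁻¹ * R⌋₊ + 1) ^ d := by
    rw [← hcard]
    refine Set.ncard_le_ncard ?_ ((Finset.finite_toSet _).image _)
    rintro _ ⟨⟨⟨x, z⟩, ⟨hx, -⟩, rfl⟩, hR'⟩
    refine ⟨(x, z), ?_, rfl⟩
    simp only [G, Finset.coe_product, Set.mem_prod, Finset.mem_coe, Fintype.mem_piFinset,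
      Finset.mem_range, Nat.lt_succ_iff]
    refine ⟨hx, fun i => Nat.le_floor ?_⟩
    have h1 := (hR' i).2
    rw [latticeTranslate_apply] at h1
    rw [inv_mul_eq_div, le_div_iff₀ hL]
    linarith [(hF hx i).1]
  have hlower {R : ℝ} (hR : 0 ≤ R) :
      F.card * ⌊(t + 2)⁻¹ * R⌋₊ ^ d ≤ (V ∩ cube d R).ncard := by
    rw [← hcard]
    refine Set.ncard_le_ncard ?_ (finite_of_separated hR Set.inter_subset_right
      (hVsep.mono Set.inter_subset_left))
    rintro _ ⟨⟨x, z⟩, hp, rfl⟩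
    simp only [G, Finset.coe_product, Set.mem_prod, Finset.mem_coe, Fintype.mem_piFinset,
      Finset.mem_range] at hp
    refine ⟨⟨(x, z), ⟨hp.1, trivial⟩, rfl⟩, fun i => ?_⟩
    obtain ⟨h0, h1⟩ := hF hp.1 i
    have h2 : (z i : ℝ) + 1 ≤ (t + 2)⁻¹ * R := by
      refine le_trans ?_ (Nat.floor_le (by positivity))
      exact_mod_cast hp.2 i
    rw [inv_mul_eq_div, le_div_iff₀ hL] at h2
    dsimp only
    rw [latticeTranslate_apply]
    constructor
    · positivity
    · nlinarith
  have hlim : Tendsto (fun R : ℝ => (⌊(t + 2)⁻¹ * R⌋₊ : ℝ) / R) atTop (𝓝 (t + 2)⁻¹) :=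
    tendsto_nat_floor_mul_div_atTop (by positivity)
  have hlim1 : Tendsto (fun R : ℝ => F.card * ((⌊(t + 2)⁻¹ * R⌋₊ : ℝ) / R) ^ d) atTop
      (𝓝 (F.card / (t + 2) ^ d)) := by
    simpa [div_eq_mul_inv] using (hlim.pow d).const_mul (F.card : ℝ)
  have hlim2 : Tendsto (fun R : ℝ => F.card * ((⌊(t + 2)⁻¹ * R⌋₊ : ℝ) / R + R⁻¹) ^ d) atTop
      (𝓝 (F.card / (t + 2) ^ d)) := by
    simpa [div_eq_mul_inv] using ((hlim.add tendsto_inv_atTop_zero).pow d).const_mul (F.card : ℝ)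
  refine ⟨V, ?_, hVsep, tendsto_of_tendsto_of_tendsto_of_le_of_le' hlim1 hlim2 ?_ ?_⟩
  · rintro _ ⟨⟨x, z⟩, ⟨hx, -⟩, rfl⟩ i
    have := (hF hx i).1
    dsimp only
    rw [latticeTranslate_apply]
    positivity
  · filter_upwards [eventually_gt_atTop 0] with R hR
    rw [div_pow, ← mul_div_assoc]
    gcongr
    exact_mod_cast hlower hR.le
  · filter_upwards [eventually_gt_atTop 0] with R hR
    rw [show (⌊(t + 2)⁻¹ * R⌋₊ : ℝ) / R + R⁻¹ = (⌊(t + 2)⁻¹ * R⌋₊ + 1) / R by ring, div_pow, ← mul_div_assoc]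
    gcongr
    exact_mod_cast hupper hR.le

theorem ncard_le_gMax_mul {t : ℝ} (ht : 0 ≤ t) {V : Set (Space d)} (hV : V ⊆ cube d t)
    (hsep : V.Pairwise fun x y => 1 < dist x y) : (V.ncard : ℝ) ≤ gMax d * (t + 2) ^ d := by
  have hfin := finite_of_separated ht hV hsep
  rw [Set.ncard_eq_toFinset_card V hfin, ← div_le_iff₀ (by positivity)]
  exact le_csSup bddAbove_packingDensities
    (card_div_mem_packingDensities ht _ (by simpa) (by simpa))

theorem maxColored_le_encard (k : ℕ) (r : ℝ) (V : Set (Space d)) :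
    maxColored k r V ≤ V.encard :=
  iSup₂_le fun U _ => (Set.encard_le_encard (Set.subset_univ U)).trans (by simp)

theorem maxColored_le_gMax {t : ℝ} (ht : 0 ≤ t) (k : ℕ) {V : Set (Space d)} (hV : V ⊆ cube d t) :
    (maxColored k 1 V : ℝ≥0∞) ≤ ENNReal.ofReal (k * (gMax d * (t + 2) ^ d)) := by
  rw [maxColored]
  simp only [ENat.toENNReal_iSup]
  refine iSup₂_le fun U ⟨c⟩ => ?_
  -- The colour classes, as subsets of the space; separation makes them finite, so `ncard` is their
  -- true size.
  let S : Fin k → Set (Space d) := fun j => {x | ∃ (hV : x ∈ V) (hU : ⟨x, hV⟩ ∈ U),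
    c ⟨⟨x, hV⟩, hU⟩ = j}
  have hS (j) : S j ⊆ cube d t := fun x hx => hV hx.1
  have hsep (j) : (S j).Pairwise fun x y => 1 < dist x y := by
    rintro x ⟨hxV, hxU, hx⟩ y ⟨hyV, hyU, hy⟩ hne
    by_contra hle
    refine c.valid (v := ⟨⟨x, hxV⟩, hxU⟩) (w := ⟨⟨y, hyV⟩, hyU⟩) ?_ (hx.trans hy.symm)
    exact ⟨fun h => hne (congrArg Subtype.val h), not_lt.1 hle⟩
  have hfin (j) : (S j).Finite := finite_of_separated ht (hS j) (hsep j)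
  have himage : Subtype.val '' U ⊆ ⋃ j, S j := by
    rintro _ ⟨x, hx, rfl⟩
    exact Set.mem_iUnion.2 ⟨_, x.2, hx, rfl⟩
  have hcard : (⋃ j, S j).ncard ≤ ∑ j, (S j).ncard := by
    simpa using Finset.set_ncard_biUnion_le Finset.univ S
  have hreal : ((⋃ j, S j).ncard : ℝ) ≤ k * (gMax d * (t + 2) ^ d) := by
    calc ((⋃ j, S j).ncard : ℝ) ≤ ∑ j, ((S j).ncard : ℝ) := by exact_mod_cast hcard
      _ ≤ ∑ _j : Fin k, gMax d * (t + 2) ^ d :=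
        Finset.sum_le_sum fun j _ => ncard_le_gMax_mul ht (hS j) (hsep j)
      _ = _ := by simp
  calc (U.encard : ℝ≥0∞) = ((Subtype.val '' U).encard : ℝ≥0∞) := by
        rw [Subtype.val_injective.encard_image]
    _ ≤ ((⋃ j, S j).encard : ℝ≥0∞) := by
        exact_mod_cast Set.encard_le_encard himage
    _ = ((⋃ j, S j).ncard : ℝ≥0∞) := by
        rw [← (Set.finite_iUnion hfin).cast_ncard_eq, ENat.toENNReal_coe]
    _ = ENNReal.ofReal ((⋃ j, S j).ncard : ℝ) := by rw [ENNReal.ofReal_natCast]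
    _ ≤ _ := ENNReal.ofReal_le_ofReal hreal

end Packing

/-! ### Cells around anchor points and the lower bound. -/

section Anchors

/-- If the vertices fall into disjoint cells around anchor points, then each cell can contribute
its own colour classes, provided that cells with the same label are far apart. -/
theorem sum_min_le_maxColored {d n m q k : ℕ} {s : ℝ} (hk : m * q ≤ k) (b : Fin n → Space d)
    (j : Fin n → Fin m) (C : Fin n → Set (Space d)) (hC : Pairwise fun i i' => Disjoint (C i) (C i'))
    (hball : ∀ i, C i ⊆ Metric.closedBall (b i) s)
    (hfar : ∀ i i', i ≠ i' → j i = j i' → 1 + 2 * s < dist (b i) (b i')) (V : Set (Space d)) :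
    ∑ i, min (V ∩ C i).encard (q : ℕ∞) ≤ maxColored k 1 V := by
  -- Keep as many points of each cell as its palette of `q` colours allows, and give them distinct
  -- colours.
  choose W hWsub hWcard using fun i =>
    Set.exists_subset_encard_eq (min_le_left (V ∩ C i).encard (q : ℕ∞))
  have hWfin (i) : (W i).Finite := by
    rw [← Set.encard_ne_top_iff, hWcard]
    exact ne_top_of_le_ne_top (ENat.natCast_ne_top q) (min_le_right _ _)
  have hcol (i) : ∃ f : Space d → ℕ, W i ⊆ f ⁻¹' (Finset.range q : Set ℕ) ∧ Set.InjOn f (W i) := by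
    refine (hWfin i).exists_injOn_of_encard_le ?_
    rw [Set.encard_coe_eq_coe_finsetCard, Finset.card_range, hWcard]
    exact min_le_right _ _
  choose f hf hfinj using hcol
  have hWdisj : Pairwise fun i i' => Disjoint (W i) (W i') := fun i i' h =>
    (hC h).mono (fun x hx => (hWsub i hx).2) fun x hx => (hWsub i' hx).2
  let U : Set V := {x | (x : Space d) ∈ ⋃ i, W i}
  have hU : U.encard = ∑ i, min (V ∩ C i).encard (q : ℕ∞) := by
    have himage : Subtype.val '' U = ⋃ i, W i := by
      refine Subtype.image_preimage_coe _ _ |>.trans (Set.inter_eq_right.2 ?_)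
      exact Set.iUnion_subset fun i x hx => (hWsub i hx).1
    rw [← Subtype.val_injective.encard_image, himage, Set.encard_iUnion_of_finite hWdisj,
      finsum_eq_sum_of_fintype]
    simp_rw [hWcard]
  rw [← hU]
  refine le_iSup₂_of_le U ?_ le_rfl
  choose c hc using fun u : U => Set.mem_iUnion.1 u.2
  -- The label of the cell selects the palette; `f` selects the colour inside it.
  let color : U → Fin m × Fin q := fun u =>
    (j (c u), ⟨f (c u) u.1, by simpa using hf _ (hc u)⟩)
  have hvalid : ∀ {u v : U}, ((geomGraph 1 V).induce U).Adj u v → color u ≠ color v := by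
    intro u v huv heq
    obtain ⟨hne, hdist⟩ : u.1 ≠ v.1 ∧ dist (u.1 : Space d) v.1 ≤ 1 := huv
    obtain ⟨hj, hq⟩ := Prod.ext_iff.1 heq
    have hq' : f (c u) u.1 = f (c v) v.1 := congrArg Fin.val hq
    by_cases hcuv : c u = c v
    · have hv := hc v
      rw [← hcuv] at hq' hv
      exact hne (Subtype.ext (hfinj _ (hc u) hv hq'))
    -- Adjacent points in different cells with one label would put the two anchors within `s + 1 +
    -- s`.
    · have h1 := hfar _ _ hcuv hj
      have h2 := Metric.mem_closedBall'.1 (hball _ (hWsub _ (hc u)).2)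
      have h3 := Metric.mem_closedBall.1 (hball _ (hWsub _ (hc v)).2)
      have h4 := dist_triangle4 (b (c u)) u.1 v.1 (b (c v))
      linarith
  have := (SimpleGraph.Coloring.mk color hvalid).colorable
  exact this.mono (by simpa using hk)

variable {d : ℕ}

theorem finite_anchors {s t : ℝ} (hs : 0 ≤ s) (ht : 0 ≤ t) {B : Set (Space d)}
    (hB : B.Pairwise fun x y => 1 + 2 * s < dist x y) :
    (B ∩ {b | ∃ x ∈ cube d t, dist x b ≤ s}).Finite := by
  -- The relevant anchors lie in `[-s, t + s]^d`; this shift moves them into a cube with corner `0`.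
  let v : Space d := WithLp.toLp 2 fun _ => s
  refine Set.Finite.of_finite_image (f := fun x => x + v) ?_ (add_left_injective v).injOn
  refine finite_of_separated (t := t + 2 * s) (by positivity) ?_ ?_
  · rintro _ ⟨b, ⟨-, x, hx, hxb⟩, rfl⟩ i
    have h1 := abs_le.1 ((abs_sub_apply_le_dist x b i).trans hxb)
    obtain ⟨h2, h3⟩ := hx i
    have h4 : (b + v) i = b i + s := rfl
    dsimp only
    rw [h4]
    constructor <;> linarith
  · rintro _ ⟨x, hx, rfl⟩ _ ⟨y, hy, rfl⟩ hne
    dsimp only at hne ⊢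
    rw [dist_add_right]
    linarith [hB hx.1 hy.1 fun h => hne (by rw [h])]

/-- The cube is the disjoint union of finitely many cells around anchor points. -/
theorem IsAnchorFamily.exists_cells {m : ℕ} {s t : ℝ} (hs : 0 ≤ s) (ht : 0 ≤ t)
    {B : Fin m → Set (Space d)} (hB : IsAnchorFamily s B) :
    ∃ (n : ℕ) (b : Fin n → Space d) (j : Fin n → Fin m) (C : Fin n → Set (Space d)),
      (∀ i, MeasurableSet (C i)) ∧ (Pairwise fun i i' => Disjoint (C i) (C i')) ∧
      (⋃ i, C i) = cube d t ∧ (∀ i, C i ⊆ Metric.closedBall (b i) s) ∧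
      ∀ i i', i ≠ i' → j i = j i' → 1 + 2 * s < dist (b i) (b i') := by
  -- A point lying in several `B j` is counted once for each label; `disjointed` then removes
  -- overlaps, possibly leaving empty cells.
  let ι := Σ j : Fin m, ↥(B j ∩ {b | ∃ x ∈ cube d t, dist x b ≤ s})
  have hfin (j : Fin m) : Finite ↥(B j ∩ {b | ∃ x ∈ cube d t, dist x b ≤ s}) :=
    finite_anchors hs ht (hB.2 j)
  obtain ⟨n, ⟨e⟩⟩ := Finite.exists_equiv_fin ι
  let D : Fin n → Set (Space d) := fun i =>
    Metric.closedBall ((e.symm i).2 : Space d) s ∩ cube d t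
  have hD (i) : MeasurableSet (D i) := measurableSet_closedBall.inter (measurableSet_cube t)
  refine ⟨n, fun i => (e.symm i).2, fun i => (e.symm i).1, disjointed D, fun i => ?_,
    disjoint_disjointed D, ?_, fun i => (disjointed_subset D i).trans Set.inter_subset_left, ?_⟩
  · exact disjointedRec (fun _ _ h => h.diff (hD _)) (hD i)
  · rw [iUnion_disjointed]
    refine subset_antisymm (Set.iUnion_subset fun i => Set.inter_subset_right) fun x hx => ?_
    obtain ⟨j, b, hb, hxb⟩ := hB.1 x
    refine Set.mem_iUnion.2 ⟨e ⟨j, b, hb, x, hx, hxb⟩, ?_, hx⟩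
    rw [e.symm_apply_apply]
    exact hxb
  · intro i i' hne hj
    dsimp only at hj ⊢
    have hne' : e.symm i ≠ e.symm i' := e.symm.injective.ne hne
    generalize e.symm i = p, e.symm i' = p' at *
    obtain ⟨j, b, hb⟩ := p
    obtain ⟨j', b', hb'⟩ := p'
    obtain rfl : j = j' := hj
    exact hB.2 j hb.1 hb'.1 fun h => hne' (by simp only at h; subst h; rfl)

/-- The lower integral is superadditive for arbitrary functions, so no measurability is asked of the
summands. -/
theorem sum_lintegral_le {Ω ι : Type*} [MeasurableSpace Ω] (P : Measure Ω) (I : Finset ι)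
    (f : ι → Ω → ℝ≥0∞) : ∑ i ∈ I, ∫⁻ ω, f i ω ∂P ≤ ∫⁻ ω, ∑ i ∈ I, f i ω ∂P := by
  classical
  induction I using Finset.induction_on with
  | empty => simp
  | insert i I hi ih =>
    simp only [Finset.sum_insert hi]
    exact (add_le_add le_rfl ih).trans (le_lintegral_add _ _)

/-! ### Expected number of coloured points. -/

section Coverage

variable {Ω : Type*} [MeasurableSpace Ω] {P : Measure Ω} {X : Ω → Set (Space d)} {lam : ℝ}

theorem IsPoissonProcess.lintegral_encard (hX : IsPoissonProcess P X lam) {t : ℝ}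
    (ht : 0 ≤ t) : ∫⁻ ω, ((X ω ∩ cube d t).encard : ℝ≥0∞) ∂P = ENNReal.ofReal (lam * t ^ d) := by
  rw [hX.lintegral_count (measurableSet_cube t) (by rw [volume_cube ht]; finiteness)
    (fun n => (n : ℝ≥0∞))]
  simp only [ENat.toENNReal_coe]
  rw [lintegral_natCast_poissonMeasure, volume_real_cube ht]
  rfl

theorem IsPoissonProcess.lintegral_maxColored_le (hX : IsPoissonProcess P X lam) {t : ℝ}
    (ht : 0 ≤ t) (k : ℕ) :
    ∫⁻ ω, (maxColored k 1 (X ω ∩ cube d t) : ℝ≥0∞) ∂P ≤ ENNReal.ofReal (lam * t ^ d) := by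
  rw [← hX.lintegral_encard ht]
  exact lintegral_mono fun ω => ENat.toENNReal_mono (maxColored_le_encard k 1 _)

theorem IsPoissonProcess.le_lintegral_maxColored (hX : IsPoissonProcess P X lam) (hlam : 0 ≤ lam)
    {m q k : ℕ} (hk : m * q ≤ k) {s t : ℝ} (hs : 0 < s) (ht : 0 ≤ t)
    {B : Fin m → Set (Space d)} (hB : IsAnchorFamily s B) :
    ENNReal.ofReal (lam * t ^ d) * poissonRatio q (lam * ballVol d s).toNNReal ≤
      ∫⁻ ω, (maxColored k 1 (X ω ∩ cube d t) : ℝ≥0∞) ∂P := by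
  obtain ⟨n, b, j, C, hCm, hCd, hCU, hball, hfar⟩ := hB.exists_cells hs.le ht
  have hCt (i) : C i ⊆ cube d t := hCU ▸ Set.subset_iUnion C i
  have hCv (i) : volume (C i) ≠ ∞ :=
    ne_top_of_le_ne_top (by rw [volume_cube ht]; finiteness) (measure_mono (hCt i))
  have hCs (i) : volume.real (C i) ≤ ballVol d s := by
    refine (measureReal_mono (hball i) measure_closedBall_lt_top.ne).trans_eq ?_
    rw [ballVol, measureReal_def, measureReal_def, Measure.addHaar_closedBall _ _ hs.le,
      Measure.addHaar_ball_of_pos _ _ hs]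
  have hsum : ENNReal.ofReal (lam * t ^ d) =
      ∑ i, ((lam * volume.real (C i)).toNNReal : ℝ≥0∞) := by
    change _ = ∑ i, ENNReal.ofReal (lam * volume.real (C i))
    rw [← ENNReal.ofReal_sum_of_nonneg fun i _ => by positivity, ← Finset.mul_sum,
      ← volume_real_cube ht, ← hCU, measureReal_iUnion_fintype hCd hCm hCv]
  calc _ = ∑ i, ((lam * volume.real (C i)).toNNReal : ℝ≥0∞) *
          poissonRatio q (lam * ballVol d s).toNNReal := by rw [hsum, Finset.sum_mul]
    _ ≤ ∑ i, ((lam * volume.real (C i)).toNNReal : ℝ≥0∞) *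
          poissonRatio q (lam * volume.real (C i)).toNNReal := by
        -- Each cell has at most the volume of the ball, and the ratio is antitone.
        gcongr with i
        exact poissonRatio_anti q (Real.toNNReal_le_toNNReal (by gcongr; exact hCs i))
    _ = ∑ i, ∫⁻ ω, ((min (X ω ∩ C i).encard (q : ℕ∞) : ℕ∞) : ℝ≥0∞) ∂P := by
        refine Finset.sum_congr rfl fun i _ => ?_
        rw [hX.lintegral_count (hCm i) (hCv i) fun n => ((min n (q : ℕ∞) : ℕ∞) : ℝ≥0∞),
          ← lintegral_min_poissonMeasure]
        refine lintegral_congr fun n => ?_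
        rw [← ENat.toENNReal_coe, (Nat.mono_cast (α := ℕ∞)).map_min]
    _ ≤ ∫⁻ ω, ∑ i, ((min (X ω ∩ C i).encard (q : ℕ∞) : ℕ∞) : ℝ≥0∞) ∂P := sum_lintegral_le _ _ _
    _ ≤ _ := by
        refine lintegral_mono fun ω => ?_
        have h := sum_min_le_maxColored hk b j C hCd hball hfar (X ω ∩ cube d t)
        have hinter (i) : X ω ∩ cube d t ∩ C i = X ω ∩ C i := by
          rw [Set.inter_assoc, Set.inter_eq_right.2 (hCt i)]
        simp only [hinter] at h
        calc _ = ((∑ i, min (X ω ∩ C i).encard (q : ℕ∞) : ℕ∞) : ℝ≥0∞) :=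
              (map_sum ENat.toENNRealRingHom _ _).symm
          _ ≤ _ := by exact_mod_cast h

end Coverage

/-- Anchor points on a cubic lattice, sorted by the residues of their coordinates. -/
theorem anchorSizes_nonempty (hd : 0 < d) {s : ℝ} (hs : 0 < s) : (anchorSizes d s).Nonempty := by
  have hd' : (0 : ℝ) < d := by exact_mod_cast hd
  -- Rounding down to the lattice of mesh `δ` moves a point by at most `√d * δ ≤ d * δ = s`.
  set δ : ℝ := s / d with hδ
  have hδ0 : 0 < δ := by positivity
  -- Distinct lattice points with equal residues mod `q` differ by at least `q * δ > 1 + 2 * s` in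
  -- some coordinate.
  obtain ⟨q, hq⟩ := exists_nat_gt ((1 + 2 * s) / δ)
  rw [div_lt_iff₀ hδ0] at hq
  have hq0 : 0 < q := by
    rcases q.eq_zero_or_pos with rfl | h
    · simp at hq; linarith
    · exact h
  have : NeZero q := ⟨hq0.ne'⟩
  let e := Fintype.equivFin (Fin d → ZMod q)
  let a : (Fin d → ℤ) → Space d := fun z => WithLp.toLp 2 fun i => δ * z i
  have ha (z i) : a z i = δ * z i := rfl
  refine ⟨_, fun c => {x | ∃ z : Fin d → ℤ, a z = x ∧ e (fun i => (z i : ZMod q)) = c}, ?_, ?_⟩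
  · intro x
    refine ⟨_, a fun i => ⌊x i / δ⌋, ⟨_, rfl, rfl⟩, ?_⟩
    rw [EuclideanSpace.dist_eq]
    refine Real.sqrt_le_iff.2 ⟨hs.le, ?_⟩
    calc ∑ i, dist (x i) (a (fun i => ⌊x i / δ⌋) i) ^ 2 ≤ ∑ _i : Fin d, δ ^ 2 := by
          refine Finset.sum_le_sum fun i _ => ?_
          have h1 := Int.floor_le (x i / δ)
          have h2 := (Int.lt_floor_add_one (x i / δ)).le
          rw [le_div_iff₀ hδ0] at h1
          rw [div_le_iff₀ hδ0] at h2
          rw [ha, Real.dist_eq, sq_abs]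
          refine pow_le_pow_left₀ ?_ ?_ 2 <;> linarith
      _ = d * δ ^ 2 := by simp
      _ ≤ d ^ 2 * δ ^ 2 := by
          gcongr
          exact_mod_cast Nat.le_self_pow two_ne_zero d
      _ = s ^ 2 := by rw [hδ]; field_simp
  · rintro c _ ⟨z, rfl, hz⟩ _ ⟨w, rfl, hw⟩ hne
    obtain ⟨i, hi⟩ : ∃ i, z i ≠ w i := Function.ne_iff.1 fun h => hne (by rw [h])
    have hmod := congrFun (e.injective (hz.trans hw.symm)) i
    have hdvd : (q : ℤ) ∣ z i - w i :=
      (ZMod.intCast_eq_intCast_iff_dvd_sub _ _ _).1 hmod.symm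
    have hle : (q : ℤ) ≤ |z i - w i| :=
      Int.le_of_dvd (abs_pos.2 (sub_ne_zero.2 hi)) ((dvd_abs _ _).2 hdvd)
    have hle' : (q : ℝ) ≤ |(z i : ℝ) - w i| := by exact_mod_cast hle
    calc 1 + 2 * s < q * δ := hq
      _ ≤ |(z i : ℝ) - w i| * δ := by gcongr
      _ = |a z i - a w i| := by
          rw [ha, ha, ← mul_sub, abs_mul, abs_of_pos hδ0, mul_comm]
      _ ≤ _ := abs_sub_apply_le_dist _ _ i

theorem exists_isAnchorFamily (hd : 0 < d) {s : ℝ} (hs : 0 < s) :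
    ∃ B : Fin (anchorNumber d s) → Set (Space d), IsAnchorFamily s B :=
  Nat.sInf_mem (anchorSizes_nonempty hd hs)

/-- Some anchor must cover the origin. Positivity is what makes `k / anchorNumber d s` tend to
infinity with `k`. -/
theorem anchorNumber_pos (hd : 0 < d) {s : ℝ} (hs : 0 < s) : 0 < anchorNumber d s := by
  obtain ⟨B, hB, -⟩ := exists_isAnchorFamily hd hs
  obtain ⟨j, -⟩ := hB 0
  exact j.pos

end Anchors

/-! ### Bounds for the limiting colouring ratio. -/

section Constant

variable {d : ℕ} {Ω : Type*} [MeasurableSpace Ω] {P : Measure Ω} {X : Ω → Set (Space d)} {lam : ℝ}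

theorem meanRatio_nonneg (hlam : 0 < lam) (k : ℕ) {t : ℝ} (ht : 0 < t) :
    0 ≤ meanRatio P X lam k t := by
  unfold meanRatio; positivity

theorem colorConst_le_meanRatio (hlam : 0 < lam) (k : ℕ) {t : ℝ} (ht : 0 < t) :
    colorConst P X lam k ≤ meanRatio P X lam k t :=
  csInf_le ⟨0, by rintro _ ⟨t, ht, rfl⟩; exact meanRatio_nonneg hlam k ht⟩ ⟨t, ht, rfl⟩

theorem IsPoissonProcess.colorConst_le_one (hX : IsPoissonProcess P X lam) (hlam : 0 < lam)
    (k : ℕ) : colorConst P X lam k ≤ 1 := by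
  refine (colorConst_le_meanRatio hlam k one_pos).trans (div_le_one_of_le₀ ?_ (by positivity))
  exact ENNReal.toReal_le_of_le_ofReal (by positivity) (hX.lintegral_maxColored_le zero_le_one k)

theorem colorConst_le_gMax [IsProbabilityMeasure P] (hlam : 0 < lam) (k : ℕ) :
    colorConst P X lam k ≤ k * gMax d / lam := by
  have hlim : Tendsto (fun t : ℝ => k * gMax d / lam * (1 + 2 * t⁻¹) ^ d) atTop
      (𝓝 (k * gMax d / lam * (1 + 2 * 0) ^ d)) :=
    (((tendsto_inv_atTop_zero.const_mul 2).const_add 1).pow d).const_mul _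
  rw [mul_zero, add_zero, one_pow, mul_one] at hlim
  refine ge_of_tendsto hlim ?_
  filter_upwards [eventually_gt_atTop 0] with t ht
  refine (colorConst_le_meanRatio hlam k ht).trans ?_
  have hg := gMax_nonneg (d := d)
  have h : ∫⁻ ω, (maxColored k 1 (X ω ∩ cube d t) : ℝ≥0∞) ∂P ≤
      ENNReal.ofReal (k * (gMax d * (t + 2) ^ d)) := by
    refine (lintegral_mono fun ω => maxColored_le_gMax ht.le k Set.inter_subset_right).trans ?_
    simp
  rw [meanRatio, div_le_iff₀ (by positivity)]
  refine (ENNReal.toReal_le_of_le_ofReal (by positivity) h).trans_eq ?_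
  rw [show t + 2 = (1 + 2 * t⁻¹) * t by field_simp, mul_pow]
  field_simp

theorem IsPoissonProcess.poissonRatio_le_colorConst (hX : IsPoissonProcess P X lam)
    (hlam : 0 < lam) {m q k : ℕ} (hk : m * q ≤ k) {s : ℝ} (hs : 0 < s)
    {B : Fin m → Set (Space d)} (hB : IsAnchorFamily s B) :
    (poissonRatio q (lam * ballVol d s).toNNReal).toReal ≤ colorConst P X lam k := by
  refine le_csInf (Set.nonempty_Ioi.image _) ?_
  rintro _ ⟨t, ht : 0 < t, rfl⟩
  -- `toReal` is monotone only below `∞`; finiteness comes from the Poisson mean `lam * t ^ d`.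
  have h := ENNReal.toReal_mono
    (ne_top_of_le_ne_top ENNReal.ofReal_ne_top (hX.lintegral_maxColored_le ht.le k))
    (hX.le_lintegral_maxColored hlam.le hk hs ht.le hB)
  rw [ENNReal.toReal_mul, ENNReal.toReal_ofReal (by positivity)] at h
  rw [meanRatio, le_div_iff₀ (by positivity), mul_comm]
  exact h

theorem IsPoissonProcess.tendsto_colorConst (hX : IsPoissonProcess P X lam) (hd : 0 < d)
    (hlam : 0 < lam) : Tendsto (fun k : ℕ => colorConst P X lam k) atTop (𝓝 1) := by
  obtain ⟨B, hB⟩ := exists_isAnchorFamily hd one_pos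
  have hlim : Tendsto (fun k : ℕ => (poissonRatio (k / anchorNumber d 1)
      (lam * ballVol d 1).toNNReal).toReal) atTop (𝓝 1) :=
    (ENNReal.tendsto_toReal ENNReal.one_ne_top).comp ((tendsto_poissonRatio _).comp
      (Nat.tendsto_div_const_atTop (anchorNumber_pos hd one_pos).ne'))
  exact tendsto_of_tendsto_of_tendsto_of_le_of_le hlim tendsto_const_nhds
    (fun k => hX.poissonRatio_le_colorConst hlam (Nat.mul_div_le k _) one_pos hB)
    fun k => hX.colorConst_le_one hlam k

end Constant

end GeomColoring

theorem mainTheorem11 {d : ℕ} (hd : 1 < d) {lam : ℝ} (hlam : 0 < lam)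
    {Ω : Type*} [MeasurableSpace Ω] (P : Measure Ω) [IsProbabilityMeasure P]
    (X : Ω → Set (GeomColoring.Space d)) (hX : GeomColoring.IsPoissonProcess P X lam) :
    -- the maximal packing density is finite
    (BddAbove (GeomColoring.packingDensities d) ∧
      GeomColoring.gMax d ≤ 1 / GeomColoring.ballVol d (1 / 2)) ∧
    -- upper bound
    (∀ k : ℕ, GeomColoring.colorConst P X lam k ≤ min 1 (k * GeomColoring.gMax d / lam)) ∧
    -- lower bound; the minimum defining `m(s)` is over a nonempty set
    (∀ s : ℝ, 0 < s →
      (GeomColoring.anchorSizes d s).Nonempty ∧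
      ∀ k : ℕ,
        GeomColoring.truncatedPoissonMean (lam * GeomColoring.ballVol d s)
            (k / GeomColoring.anchorNumber d s) / (lam * GeomColoring.ballVol d s)
          ≤ GeomColoring.colorConst P X lam k) ∧
    -- the limit of many colours
    Tendsto (fun k : ℕ => GeomColoring.colorConst P X lam k) atTop (𝓝 1) := by
  have hd0 : 0 < d := by lia
  refine ⟨⟨GeomColoring.bddAbove_packingDensities, GeomColoring.gMax_le⟩,
    fun k => le_min (hX.colorConst_le_one hlam k) (GeomColoring.colorConst_le_gMax hlam k),
    fun s hs => ⟨GeomColoring.anchorSizes_nonempty hd0 hs, fun k => ?_⟩,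
    hX.tendsto_colorConst hd0 hlam⟩
  obtain ⟨B, hB⟩ := GeomColoring.exists_isAnchorFamily hd0 hs
  rw [GeomColoring.truncatedPoissonMean_div (mul_pos hlam (GeomColoring.ballVol_pos hs))]
  exact hX.poissonRatio_le_colorConst hlam (Nat.mul_div_le k _) hs hB
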